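/- Let $n\ge 3$, let $m,\omega\in\mathbb R$, and let $N:[0,\infty)\to\mathbb R$ be of class $C^1$ with $N(0)=N'(0)=0$. Put $W(s)=\frac{m^2}{2}s^2+N(s)$ for $s\ge 0$. Assume that there are $0\le s_0<s_1$ with $N(s_0)<0$ and $N'(s_1)\ge 0$. Set $$\tilde N(s)=\begin{cases}N(s), & 0\le s\le s_1,\\ N'(s_1)\,s+c_1, & s\ge s_1,\end{cases}\qquad c_1=N(s_1)-N'(s_1)s_1,\qquad \tilde W(s)=\frac{m^2}{2}s^2+\tilde N(s).$$ As usual for the Klein–Gordon equation, potentials act on field values $u\in\mathbb R$ through $u\mapsto W(|u|)$, so that $W'(u)$ means $W'(|u|)\,u/|u|$ for $u\neq0$ and $W'(0)=0$; likewise for $\tilde W$. If $m^2\ge\omega^2$, then every real-valued weak solution $u\in H^1(\mathbb R^n)$ of $$-\Delta u+\tilde W'(u)=\omega^2u\quad\text{in }\mathbb R^n$$ satisfies $u\le s_1$ almost everywhere. In particular, if moreover $u\ge0$ almost everywhere, then $u$ is a weak solution of the original equation $-\Delta u+W'(u)=\omega^2u$ in $\mathbb R^n$ (no growth condition on $N$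 at infinity being assumed). -/

import Mathlib

open MeasureTheory

noncomputable section

namespace KleinGordon

/-- The potential `W(s) = (m² / 2) s² + N(s)`, `s ≥ 0`. -/
def potential (m : ℝ) (N : ℝ → ℝ) (s : ℝ) : ℝ :=
  m ^ 2 / 2 * s ^ 2 + N s

/-- The modified nonlinearity `Ñ`: it equals `N(s)` for `s ≤ s₁` and is continued for `s ≥ s₁` by
the affine function `N'(s₁) s + c₁` with `c₁ = N(s₁) - N'(s₁) s₁`. -/
def modifiedNonlinearity (N : ℝ → ℝ) (s₁ s : ℝ) : ℝ :=
  if s ≤ s₁ then N s else deriv N s₁ * s + (N s₁ - deriv N s₁ * s₁)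

/-- The nonlinear term of the field equation. A function `F` of `s ≥ 0` acts on field values
through `u ↦ F(|u|)`, whose derivative is `F'(|u|) u / |u|`; at `u = 0` it is `0`, which is the
correct value when `F'(0) = 0`. For `u > 0` this is `F'(u)`. -/
def fieldDeriv (F : ℝ → ℝ) (u : ℝ) : ℝ :=
  deriv F |u| * (u / |u|)

/-- `G` is the weak gradient of `u` on `ℝⁿ`. -/
def IsWeakGradient {n : ℕ} (u : EuclideanSpace ℝ (Fin n) → ℝ)
    (G : EuclideanSpace ℝ (Fin n) → EuclideanSpace ℝ (Fin n)) : Prop :=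
  LocallyIntegrable u ∧ LocallyIntegrable G ∧
    ∀ φ : EuclideanSpace ℝ (Fin n) → ℝ, ContDiff ℝ (⊤ : ℕ∞) φ → HasCompactSupport φ →
      ∀ e : EuclideanSpace ℝ (Fin n),
        ∫ x, u x * fderiv ℝ φ x e = - ∫ x, inner ℝ (G x) e * φ x

/-- `u` belongs to `H¹(ℝⁿ)` and is a weak solution of `-Δu + F'(u) = ω² u` on `ℝⁿ`, where `F'(u)`
is the nonlinear term `fieldDeriv F u`: with `G = ∇u`, for all test functions `φ`,
`∫ (∇u · ∇φ + F'(u) φ) = ω² ∫ u φ`. (`fderiv ℝ φ x (G x)` is `∇φ(x) · G(x)`.) -/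
def IsH1Solution {n : ℕ} (F : ℝ → ℝ) (ω : ℝ) (u : EuclideanSpace ℝ (Fin n) → ℝ) : Prop :=
  MemLp u 2 ∧ LocallyIntegrable (fun x => fieldDeriv F (u x)) ∧
    ∃ G : EuclideanSpace ℝ (Fin n) → EuclideanSpace ℝ (Fin n),
      MemLp G 2 ∧ IsWeakGradient u G ∧
      ∀ φ : EuclideanSpace ℝ (Fin n) → ℝ, ContDiff ℝ (⊤ : ℕ∞) φ → HasCompactSupport φ →
        ∫ x, (fderiv ℝ φ x (G x) + fieldDeriv F (u x) * φ x) = ω ^ 2 * ∫ x, u x * φ x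

end KleinGordon

end

/-! Write the modified equation as `-Δu + q = 0`. Where `u > s₁` one has `q = (m² - ω²) u + N'(s₁) ≥
0`, so a weak maximum principle applies. Let `β` be smooth, bounded and nondecreasing, zero exactly
on `(-∞, s₁]`. Formally, testing with `β(u)` gives `∫ β'(u) |∇u|² + ∫ β(u) q = 0` with both terms
nonnegative. Hence `β(u)` has zero gradient, so it is constant; it lies in `L²(ℝⁿ)`, so it vanishes,
that is `u ≤ s₁`. If also `u ≥ 0`, then `u` takes values where the two nonlinear terms agree.

The test function `β(u)` is neither smooth nor compactly supported. Mollification repairs the first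
defect (`integral_test_comp_mul`), a dilated cutoff the second (`deriv_comp_smul_ae_eq_zero`). The
chain rule `isWeakGradient_comp` and `ae_eq_zero_of_isWeakGradient_zero` then give
`ae_le_of_weak_solution`. -/

namespace KleinGordon

open Filter Topology ContinuousLinearMap
open scoped Convolution ENNReal

/-! ### Mollification in `L²`. -/

/-- A sequence of bump functions shrinking to the origin. -/
noncomputable def shrinkingBump (E : Type*) [NormedAddCommGroup E] (k : ℕ) : ContDiffBump (0 : E) where
  rIn := 1 / (k + 1)
  rOut := 2 / (k + 1)
  rIn_pos := by positivity
  rIn_lt_rOut := by gcongr; norm_num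

theorem tendsto_shrinkingBump_rOut (E : Type*) [NormedAddCommGroup E] :
    Tendsto (fun k => (shrinkingBump E k).rOut) atTop (𝓝 0) := by
  have := (tendsto_one_div_add_atTop_nhds_zero_nat (𝕜 := ℝ)).const_mul 2
  simpa [shrinkingBump, div_eq_mul_inv] using this

/-- Jensen's inequality for the square. -/
theorem sq_lintegral_mul_le {α : Type*} [MeasurableSpace α] {ν : Measure α} {k h : α → ℝ≥0∞}
    (hk : AEMeasurable k ν) (hk1 : ∫⁻ x, k x ∂ν = 1) (hh : AEMeasurable h ν) :
    (∫⁻ x, k x * h x ∂ν) ^ 2 ≤ ∫⁻ x, k x * h x ^ 2 ∂ν := by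
  have hp : IsProbabilityMeasure (ν.withDensity k) := ⟨by rw [withDensity_apply _ MeasurableSet.univ, setLIntegral_univ, hk1]⟩
  have hac : ν.withDensity k ≪ ν := withDensity_absolutelyContinuous _ _
  -- On the probability measure with density `k`, the `L¹` norm is at most the `L²` norm.
  have h1 := eLpNorm_le_eLpNorm_of_exponent_le (μ := ν.withDensity k) (f := h) (p := 1) (q := 2)
    (by norm_num) (hh.mono_ac hac).aestronglyMeasurable
  rw [eLpNorm_one_eq_lintegral_enorm,
    eLpNorm_eq_lintegral_rpow_enorm_toReal (by norm_num) (by norm_num)] at h1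
  simp only [enorm_eq_self, ENNReal.toReal_ofNat] at h1
  rw [lintegral_withDensity_eq_lintegral_mul₀ hk hh,
    lintegral_withDensity_eq_lintegral_mul₀ hk (hh.pow_const _)] at h1
  simp only [Pi.mul_apply, ENNReal.rpow_ofNat] at h1
  calc _ ≤ ((∫⁻ x, k x * h x ^ 2 ∂ν) ^ (1 / 2 : ℝ)) ^ 2 := by gcongr
    _ = _ := by
      rw [← ENNReal.rpow_ofNat, ← ENNReal.rpow_mul]; norm_num

/-- Almost everywhere convergence without gain of `L²` mass is convergence in `L²`. -/
theorem tendsto_lintegral_enorm_sub_sq {α F : Type*} [MeasurableSpace α] [NormedAddCommGroup F]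
    {ν : Measure α} {g : ℕ → α → F} {f : α → F}
    (hg : ∀ k, AEStronglyMeasurable (g k) ν)
    (hf : AEStronglyMeasurable f ν) (hfin : ∫⁻ x, ‖f x‖ₑ ^ 2 ∂ν ≠ ∞)
    (hle : ∀ k, ∫⁻ x, ‖g k x‖ₑ ^ 2 ∂ν ≤ ∫⁻ x, ‖f x‖ₑ ^ 2 ∂ν)
    (hlim : ∀ᵐ x ∂ν, Tendsto (fun k => g k x) atTop (𝓝 (f x))) :
    Tendsto (fun k => ∫⁻ x, ‖g k x - f x‖ₑ ^ 2 ∂ν) atTop (𝓝 0) := by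
  set I := ∫⁻ x, ‖f x‖ₑ ^ 2 ∂ν with hI
  -- Fatou is applied to `A k - D k ≥ 0`, which tends to `4‖f‖²`. Since `∫ A k ≤ 4I`, no mass is
  -- left for `∫ D k` in the limit.
  set A : ℕ → α → ℝ≥0∞ := fun k x => 2 * ‖g k x‖ₑ ^ 2 + 2 * ‖f x‖ₑ ^ 2 with hA
  set D : ℕ → α → ℝ≥0∞ := fun k x => ‖g k x - f x‖ₑ ^ 2 with hD
  have hAm : ∀ k, AEMeasurable (A k) ν := fun k =>
    (((hg k).enorm.pow_const 2).const_mul 2).add ((hf.enorm.pow_const 2).const_mul 2)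
  have hDm : ∀ k, AEMeasurable (D k) ν := fun k => ((hg k).sub hf).enorm.pow_const 2
  have hDA : ∀ k x, D k x ≤ A k x := by
    intro k x
    have h1 : ‖g k x - f x‖ ^ 2 ≤ 2 * ‖g k x‖ ^ 2 + 2 * ‖f x‖ ^ 2 := by
      have := norm_sub_le (g k x) (f x)
      nlinarith [sq_nonneg (‖g k x‖ - ‖f x‖), norm_nonneg (g k x - f x)]
    simp only [hA, hD, ← ofReal_norm]
    rw [← ENNReal.ofReal_pow (norm_nonneg _), ← ENNReal.ofReal_pow (norm_nonneg _),
      ← ENNReal.ofReal_pow (norm_nonneg _), ← ENNReal.ofReal_ofNat 2,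
      ← ENNReal.ofReal_mul (by norm_num), ← ENNReal.ofReal_mul (by norm_num),
      ← ENNReal.ofReal_add (by positivity) (by positivity)]
    exact ENNReal.ofReal_le_ofReal h1
  have hAint : ∀ k, ∫⁻ x, A k x ∂ν ≤ 4 * I := by
    intro k
    simp only [hA]
    rw [lintegral_add_left' (((hg k).enorm.pow_const 2).const_mul 2),
      lintegral_const_mul' _ _ (by norm_num), lintegral_const_mul' _ _ (by norm_num)]
    calc _ ≤ 2 * I + 2 * I := by gcongr; exact hle k
      _ = 4 * I := by rw [← add_mul]; norm_num
  have hfat : 4 * I ≤ liminf (fun k => ∫⁻ x, (A k x - D k x) ∂ν) atTop := by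
    refine le_trans (le_of_eq ?_) (lintegral_liminf_le' fun k => (hAm k).sub (hDm k))
    rw [hI, ← lintegral_const_mul' _ _ (by norm_num)]
    refine lintegral_congr_ae ?_
    filter_upwards [hlim] with x hx
    have h1 : Tendsto (fun k => A k x) atTop (𝓝 (2 * ‖f x‖ₑ ^ 2 + 2 * ‖f x‖ₑ ^ 2)) :=
      (ENNReal.Tendsto.const_mul (ENNReal.Tendsto.pow hx.enorm) (Or.inr (by norm_num))).add
        tendsto_const_nhds
    have h2 : Tendsto (fun k => D k x) atTop (𝓝 0) := by
      have := ENNReal.Tendsto.pow (n := 2) ((hx.sub_const (f x)).enorm)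
      simpa using this
    have h3 := ENNReal.Tendsto.sub h1 h2 (Or.inr (by norm_num))
    rw [h3.liminf_eq, tsub_zero, ← add_mul]
    norm_num
  have h4I : 4 * I ≠ ∞ := ENNReal.mul_ne_top (by norm_num) hfin
  rw [ENNReal.tendsto_nhds_zero]
  intro ε hε
  -- The strict inequality `4I - ε < 4I` fails when `I = 0`.
  rcases eq_or_ne I 0 with hI0 | hI0
  · refine Eventually.of_forall fun k => ?_
    calc _ ≤ ∫⁻ x, A k x ∂ν := lintegral_mono (hDA k)
      _ ≤ 4 * I := hAint k
      _ ≤ ε := by simp [hI0]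
  · have h4 : 4 * I - ε < liminf (fun k => ∫⁻ x, (A k x - D k x) ∂ν) atTop :=
      (ENNReal.sub_lt_self h4I (by simp [hI0]) hε.ne').trans_le hfat
    filter_upwards [eventually_lt_of_lt_liminf h4] with k hk
    have hsum : ∫⁻ x, (A k x - D k x) ∂ν + ∫⁻ x, D k x ∂ν = ∫⁻ x, A k x ∂ν := by
      rw [← lintegral_add_right' _ (hDm k)]
      exact lintegral_congr fun x => tsub_add_cancel_of_le (hDA k x)
    have hne : ∫⁻ x, (A k x - D k x) ∂ν ≠ ∞ :=
      ne_top_of_le_ne_top h4I ((le_self_add.trans hsum.le).trans (hAint k))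
    have h5 : ∫⁻ x, (A k x - D k x) ∂ν + ∫⁻ x, D k x ∂ν ≤
        ∫⁻ x, (A k x - D k x) ∂ν + ε := by
      rw [hsum]
      refine (hAint k).trans ?_
      exact tsub_le_iff_right.mp hk.le
    exact (ENNReal.add_le_add_iff_left hne).mp h5

section Mollification

variable {E : Type*} [NormedAddCommGroup E] [NormedSpace ℝ E] [FiniteDimensional ℝ E]
  [MeasurableSpace E] [BorelSpace E] {μ : Measure E} [μ.IsAddHaarMeasure]
  {F : Type*} [NormedAddCommGroup F] [NormedSpace ℝ F]

/-- Young's inequality for `L¹ * L²`: Jensen with weight `‖k‖`, then Tonelli and translation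
invariance. -/
theorem lintegral_enorm_convolution_sq_le {k : E → ℝ} {g : E → F} (hk : AEStronglyMeasurable k μ)
    (hk1 : ∫⁻ x, ‖k x‖ₑ ∂μ = 1) (hg : AEStronglyMeasurable g μ) :
    ∫⁻ x, ‖(k ⋆[lsmul ℝ ℝ, μ] g : E → F) x‖ₑ ^ 2 ∂μ ≤ ∫⁻ x, ‖g x‖ₑ ^ 2 ∂μ := by
  have hm : AEStronglyMeasurable (fun p : E × E => g (p.1 - p.2)) (μ.prod μ) :=
    hg.comp_quasiMeasurePreserving (quasiMeasurePreserving_sub_of_right_invariant μ μ)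
  calc _ ≤ ∫⁻ x, ∫⁻ t, ‖k t‖ₑ * ‖g (x - t)‖ₑ ^ 2 ∂μ ∂μ := by
        refine lintegral_mono fun x => ?_
        refine le_trans ?_ (sq_lintegral_mul_le hk.enorm hk1
          (hg.comp_quasiMeasurePreserving
            (quasiMeasurePreserving_sub_left_of_right_invariant μ x)).enorm)
        gcongr
        rw [convolution_lsmul]
        refine (enorm_integral_le_lintegral_enorm _).trans_eq ?_
        simp [enorm_smul]
    _ = ∫⁻ t, ∫⁻ x, ‖k t‖ₑ * ‖g (x - t)‖ₑ ^ 2 ∂μ ∂μ := by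
        refine lintegral_lintegral_swap ?_
        exact (hk.enorm.comp_snd).mul (hm.enorm.pow_const 2)
    _ = ∫⁻ t, ‖k t‖ₑ * ∫⁻ x, ‖g x‖ₑ ^ 2 ∂μ ∂μ := by
        refine lintegral_congr fun t => ?_
        rw [lintegral_const_mul' _ _ enorm_ne_top,
          lintegral_sub_right_eq_self (fun x => ‖g x‖ₑ ^ 2) t]
    _ = _ := by
        rw [lintegral_mul_const'' _ hk.enorm, hk1, one_mul]

theorem lintegral_enorm_normed (φ : ContDiffBump (0 : E)) : ∫⁻ x, ‖φ.normed μ x‖ₑ ∂μ = 1 := by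
  have h := ofReal_integral_eq_lintegral_ofReal (φ.integrable_normed (μ := μ))
    (Eventually.of_forall φ.nonneg_normed)
  rw [φ.integral_normed, ENNReal.ofReal_one] at h
  rw [h]
  exact lintegral_congr fun x => Real.enorm_of_nonneg (φ.nonneg_normed x)

theorem ae_tendsto_mollification [CompleteSpace F] {g : E → F} (hg : LocallyIntegrable g μ) :
    ∀ᵐ x ∂μ, Tendsto
      (fun k => ((shrinkingBump E k).normed μ ⋆[lsmul ℝ ℝ, μ] g : E → F) x) atTop (𝓝 (g x)) :=
  -- Lebesgue differentiation needs `rOut / rIn` bounded; here the ratio is always `2`.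
  ContDiffBump.ae_convolution_tendsto_right_of_locallyIntegrable (K := 2)
    (tendsto_shrinkingBump_rOut E)
    (Eventually.of_forall fun k => by simp [shrinkingBump, div_eq_mul_inv]) hg

theorem memLp_mollification {g : E → F} (hg : MemLp g 2 μ) (φ : ContDiffBump (0 : E)) :
    MemLp (φ.normed μ ⋆[lsmul ℝ ℝ, μ] g : E → F) 2 μ := by
  have hc : Continuous (φ.normed μ ⋆[lsmul ℝ ℝ, μ] g : E → F) :=
    φ.hasCompactSupport_normed.continuous_convolution_left _ φ.continuous_normed
      (hg.locallyIntegrable (by norm_num))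
  refine ⟨hc.aestronglyMeasurable, ?_⟩
  have h2 := hg.2
  rw [eLpNorm_lt_top_iff_lintegral_rpow_enorm_lt_top (by norm_num) (by norm_num)] at h2 ⊢
  simp only [ENNReal.toReal_ofNat, ENNReal.rpow_ofNat] at h2 ⊢
  exact (lintegral_enorm_convolution_sq_le φ.continuous_normed.aestronglyMeasurable
    (lintegral_enorm_normed φ) hg.1).trans_lt h2

theorem tendsto_mollification_L2 [CompleteSpace F] {g : E → F} (hg : MemLp g 2 μ) :
    Tendsto (fun k => ∫⁻ x, ‖((shrinkingBump E k).normed μ ⋆[lsmul ℝ ℝ, μ] g : E → F) x - g x‖ₑ ^ 2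
      ∂μ) atTop (𝓝 0) := by
  refine tendsto_lintegral_enorm_sub_sq (fun k => (memLp_mollification hg _).1) hg.1 ?_
    (fun k => lintegral_enorm_convolution_sq_le
      (shrinkingBump E k).continuous_normed.aestronglyMeasurable (lintegral_enorm_normed _) hg.1)
    (ae_tendsto_mollification (hg.locallyIntegrable (by norm_num)))
  have h2 := hg.2
  rw [eLpNorm_lt_top_iff_lintegral_rpow_enorm_lt_top (by norm_num) (by norm_num)] at h2
  simpa using h2.ne

end Mollification

/-! ### Weak gradients and smooth approximation in `H¹`. -/

/-- The derivative falls on the kernel, and `t ↦ ρ(x - t)` is an admissible test function for the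
weak gradient. The sign from reflecting the argument cancels the one from integration by parts. -/
theorem fderiv_mollification {n : ℕ} {u : EuclideanSpace ℝ (Fin n) → ℝ}
    {G : EuclideanSpace ℝ (Fin n) → EuclideanSpace ℝ (Fin n)} (h : IsWeakGradient u G)
    (ρ : ContDiffBump (0 : EuclideanSpace ℝ (Fin n))) (x e : EuclideanSpace ℝ (Fin n)) :
    fderiv ℝ (ρ.normed volume ⋆[lsmul ℝ ℝ, volume] u) x e =
      inner ℝ ((ρ.normed volume ⋆[lsmul ℝ ℝ, volume] G) x) e := by
  obtain ⟨hu, hG, hw⟩ := h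
  have hρ : ContDiff ℝ (⊤ : ℕ∞) (ρ.normed volume) := ρ.contDiff_normed
  have hρc := ρ.hasCompactSupport_normed (μ := volume)
  have hd := hρc.hasFDerivAt_convolution_left (lsmul ℝ ℝ) (hρ.of_le (by simp)) hu x
  rw [hd.fderiv, convolution_eq_swap]
  have hcd : Continuous (fderiv ℝ (ρ.normed volume)) := hρ.continuous_fderiv (by simp)
  have hint : Integrable (fun t =>
      ((lsmul ℝ ℝ).precompL (EuclideanSpace ℝ (Fin n)) (fderiv ℝ (ρ.normed volume) (x - t))) (u t)) := by
    have := (hρc.fderiv (𝕜 := ℝ)).convolutionExists_left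
      ((lsmul ℝ ℝ : ℝ →L[ℝ] ℝ →L[ℝ] ℝ).precompL (EuclideanSpace ℝ (Fin n))) hcd hu x
    exact this.integrable_swap
  rw [ContinuousLinearMap.integral_apply hint]
  have hint2 : Integrable (fun t => (ρ.normed volume (x - t)) • G t) := by
    have := hρc.convolutionExists_left (lsmul ℝ ℝ) hρ.continuous hG x
    exact this.integrable_swap
  rw [convolution_lsmul_swap, real_inner_comm, ← integral_inner hint2]
  have ht := hw (fun t => ρ.normed volume (x - t)) (hρ.comp (contDiff_const.sub contDiff_id))
    (hρc.comp_homeomorph (Homeomorph.subLeft x)) e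
  have hfd : ∀ t, fderiv ℝ (fun t => ρ.normed volume (x - t)) t e =
      - fderiv ℝ (ρ.normed volume) (x - t) e := by
    intro t
    have h1 : HasFDerivAt (ρ.normed volume) (fderiv ℝ (ρ.normed volume) (x - t)) (x - t) :=
      (hρ.differentiable (by simp) _).hasFDerivAt
    have h2 := h1.comp t ((hasFDerivAt_id t).const_sub x)
    have h3 : fderiv ℝ (fun t => ρ.normed volume (x - t)) t = _ := h2.fderiv
    rw [h3]
    simp
  simp only [hfd, mul_neg, integral_neg, neg_inj] at ht
  calc _ = ∫ t, u t * fderiv ℝ (ρ.normed volume) (x - t) e := by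
        refine integral_congr_ae (Eventually.of_forall fun t => ?_)
        simp [ContinuousLinearMap.precompL_apply, mul_comm]
    _ = _ := ht
    _ = _ := by
        refine integral_congr_ae (Eventually.of_forall fun t => ?_)
        simp only [inner_smul_right, real_inner_comm e]
        ring

theorem integrable_inner_of_memLp {α H : Type*} [MeasurableSpace α] {ν : Measure α}
    [NormedAddCommGroup H] [InnerProductSpace ℝ H] {f g : α → H} (hf : MemLp f 2 ν)
    (hg : MemLp g 2 ν) : Integrable (fun x => inner ℝ (f x) (g x)) ν :=
  (hf.norm.integrable_mul hg.norm).mono' (hf.1.inner hg.1)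
    (Eventually.of_forall fun _ => norm_inner_le_norm _ _)

/-- Split `V k = (V k - G) + G`: Cauchy–Schwarz makes the first part vanish, dominated convergence
handles the second. It is applied with `c k = β'(v k)`, which converges only almost everywhere but
is bounded. -/
theorem tendsto_integral_mul_inner {α H : Type*} [MeasurableSpace α] {ν : Measure α}
    [NormedAddCommGroup H] [InnerProductSpace ℝ H] {V : ℕ → α → H} {G P : α → H} {c : ℕ → α → ℝ}
    {d : α → ℝ} {C : ℝ} (hV : ∀ k, MemLp (V k) 2 ν) (hG : MemLp G 2 ν) (hP : MemLp P 2 ν)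
    (hc : ∀ k, AEStronglyMeasurable (c k) ν) (hcC : ∀ k x, |c k x| ≤ C)
    (hcd : ∀ᵐ x ∂ν, Tendsto (fun k => c k x) atTop (𝓝 (d x)))
    (hVG : Tendsto (fun k => ∫⁻ x, ‖V k x - G x‖ₑ ^ 2 ∂ν) atTop (𝓝 0)) :
    Tendsto (fun k => ∫ x, c k x * inner ℝ (V k x) (P x) ∂ν) atTop
      (𝓝 (∫ x, d x * inner ℝ (G x) (P x) ∂ν)) := by
  have hGP : Integrable (fun x => inner ℝ (G x) (P x)) ν := integrable_inner_of_memLp hG hP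
  have h1 : Tendsto (fun k => ∫ x, c k x * inner ℝ (G x) (P x) ∂ν) atTop
      (𝓝 (∫ x, d x * inner ℝ (G x) (P x) ∂ν)) := by
    refine tendsto_integral_of_dominated_convergence (fun x => C * ‖inner ℝ (G x) (P x)‖)
      (fun k => (hc k).mul hGP.1) (hGP.norm.const_mul C)
      (fun k => Eventually.of_forall fun x => ?_) ?_
    · rw [norm_mul]
      exact mul_le_mul_of_nonneg_right (hcC k x) (norm_nonneg _)
    · filter_upwards [hcd] with x hx
      exact hx.mul_const _
  have hdiff : ∀ k, Integrable (fun x => c k x * inner ℝ (V k x - G x) (P x)) ν := fun k =>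
    (integrable_inner_of_memLp ((hV k).sub hG) hP).bdd_mul (hc k)
      (Eventually.of_forall fun x => hcC k x)
  have hcGP : ∀ k, Integrable (fun x => c k x * inner ℝ (G x) (P x)) ν := fun k =>
    hGP.bdd_mul (hc k) (Eventually.of_forall fun x => hcC k x)
  have h2 : Tendsto (fun k => ∫ x, c k x * inner ℝ (V k x - G x) (P x) ∂ν) atTop (𝓝 0) := by
    rw [tendsto_zero_iff_enorm_tendsto_zero]
    set K : ℝ≥0∞ := ‖C‖ₑ * (∫⁻ x, ‖P x‖ₑ ^ 2 ∂ν) ^ (1 / 2 : ℝ) with hK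
    have hKtop : K ≠ ∞ := by
      have hP2 := hP.2
      rw [eLpNorm_lt_top_iff_lintegral_rpow_enorm_lt_top (by norm_num) (by norm_num)] at hP2
      simp only [ENNReal.toReal_ofNat, ENNReal.rpow_ofNat] at hP2
      exact ENNReal.mul_ne_top enorm_ne_top (ENNReal.rpow_ne_top_of_nonneg (by norm_num) hP2.ne)
    have hz : Tendsto (fun k => K * (∫⁻ x, ‖V k x - G x‖ₑ ^ 2 ∂ν) ^ (1 / 2 : ℝ)) atTop (𝓝 0) := by
      have h3 := (ENNReal.continuous_rpow_const (y := (1 / 2 : ℝ))).tendsto 0 |>.comp hVG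
      have h4 := ENNReal.Tendsto.const_mul (a := K) h3 (Or.inr hKtop)
      simpa using h4
    refine tendsto_of_tendsto_of_tendsto_of_le_of_le tendsto_const_nhds hz (fun _ => zero_le)
      fun k => ?_
    have hm1 : AEMeasurable (fun x => ‖V k x - G x‖ₑ) ν := ((hV k).1.sub hG.1).enorm
    have hm2 : AEMeasurable (fun x => ‖P x‖ₑ) ν := hP.1.enorm
    have hol := ENNReal.lintegral_mul_le_Lp_mul_Lq ν (p := 2) (q := 2)
      ⟨by norm_num, by norm_num, by norm_num⟩ hm1 hm2
    simp only [Pi.mul_apply, ENNReal.rpow_ofNat] at hol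
    calc _ ≤ ∫⁻ x, ‖c k x * inner ℝ (V k x - G x) (P x)‖ₑ ∂ν := enorm_integral_le_lintegral_enorm _
      _ ≤ ∫⁻ x, ‖C‖ₑ * (‖V k x - G x‖ₑ * ‖P x‖ₑ) ∂ν := by
        refine lintegral_mono fun x => ?_
        rw [enorm_mul]
        gcongr
        · rw [enorm_le_iff_norm_le]
          exact (hcC k x).trans (le_abs_self C)
        · rw [← enorm_norm (V k x - G x), ← enorm_norm (P x), ← enorm_mul, enorm_le_iff_norm_le]
          exact (norm_inner_le_norm _ _).trans (le_abs_self _)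
      _ = ‖C‖ₑ * ∫⁻ x, ‖V k x - G x‖ₑ * ‖P x‖ₑ ∂ν := lintegral_const_mul' _ _ enorm_ne_top
      _ ≤ _ := by
        rw [hK, mul_assoc]
        gcongr
        rw [mul_comm]
        exact hol
  have h3 := h2.add h1
  rw [zero_add] at h3
  refine h3.congr fun k => ?_
  rw [← integral_add (hdiff k) (hcGP k)]
  refine integral_congr_ae (Eventually.of_forall fun x => ?_)
  simp only [inner_sub_left]
  ring

variable {n : ℕ} {u : EuclideanSpace ℝ (Fin n) → ℝ}
  {G : EuclideanSpace ℝ (Fin n) → EuclideanSpace ℝ (Fin n)}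

/-- Meyers–Serrin approximation of a function in `H¹(ℝⁿ)`. -/
theorem exists_smooth_approximation (hu : MemLp u 2) (hG : MemLp G 2) (h : IsWeakGradient u G) :
    ∃ (v : ℕ → EuclideanSpace ℝ (Fin n) → ℝ)
      (V : ℕ → EuclideanSpace ℝ (Fin n) → EuclideanSpace ℝ (Fin n)),
      (∀ k, ContDiff ℝ (⊤ : ℕ∞) (v k)) ∧ (∀ k x e, fderiv ℝ (v k) x e = inner ℝ (V k x) e) ∧
      (∀ k, MemLp (V k) 2) ∧ (∀ᵐ x, Tendsto (fun k => v k x) atTop (𝓝 (u x))) ∧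
      Tendsto (fun k => ∫⁻ x, ‖V k x - G x‖ₑ ^ 2) atTop (𝓝 0) := by
  refine ⟨fun k => (shrinkingBump _ k).normed volume ⋆[lsmul ℝ ℝ, volume] u,
    fun k => (shrinkingBump _ k).normed volume ⋆[lsmul ℝ ℝ, volume] G, fun k => ?_,
    fun k x e => fderiv_mollification h _ x e, fun k => memLp_mollification hG _,
    ae_tendsto_mollification (hu.locallyIntegrable (by norm_num)), tendsto_mollification_L2 hG⟩
  exact (shrinkingBump _ k).hasCompactSupport_normed.contDiff_convolution_left _
    (shrinkingBump _ k).contDiff_normed (hu.locallyIntegrable (by norm_num))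

/-- An `L²` function on `ℝⁿ`, `n ≥ 1`, with vanishing weak gradient vanishes. -/
theorem ae_eq_zero_of_isWeakGradient_zero (hn : n ≠ 0) (hu : MemLp u 2)
    (h : IsWeakGradient u 0) : u =ᵐ[volume] 0 := by
  set v : ℕ → EuclideanSpace ℝ (Fin n) → ℝ :=
    fun k => (shrinkingBump _ k).normed volume ⋆[lsmul ℝ ℝ, volume] u
  have hlim : ∀ᵐ x, Tendsto (fun k => v k x) atTop (𝓝 (u x)) := ae_tendsto_mollification h.1
  have hv : ∀ k, ContDiff ℝ (⊤ : ℕ∞) (v k) := fun k =>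
    (shrinkingBump _ k).hasCompactSupport_normed.contDiff_convolution_left _
      (shrinkingBump _ k).contDiff_normed h.1
  have hvV : ∀ k x e, fderiv ℝ (v k) x e = 0 := fun k x e =>
    (fderiv_mollification h _ x e).trans (by simp)
  have hconst : ∀ k x y, v k x = v k y := fun k x y =>
    is_const_of_fderiv_eq_zero ((hv k).differentiable (by simp))
      (fun z => ContinuousLinearMap.ext fun e => hvV k z e) x y
  obtain ⟨x₀, hx₀⟩ := hlim.exists
  have hae : u =ᵐ[volume] fun _ => u x₀ := by
    filter_upwards [hlim] with x hx
    exact tendsto_nhds_unique (hx.congr fun k => hconst k x x₀) hx₀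
  have hcLp : MemLp (fun _ : EuclideanSpace ℝ (Fin n) => u x₀) 2 :=
    (memLp_congr_ae hae).mp hu
  -- In positive dimension the volume is infinite, so the only constant in `L²` is zero.
  have : Nontrivial (EuclideanSpace ℝ (Fin n)) := by
    have : Nonempty (Fin n) := ⟨⟨0, Nat.pos_of_ne_zero hn⟩⟩
    infer_instance
  rw [memLp_const_iff (by norm_num) (by norm_num)] at hcLp
  have h0 : u x₀ = 0 := by
    rcases hcLp with h | h
    · exact h
    · simp at h
  filter_upwards [hae] with x hx
  rw [hx, h0]; rfl

/-! ### Chain rule for `β(u)`. -/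

section Composition

variable {β : ℝ → ℝ} {B C : ℝ}

theorem fderiv_comp_of_fderiv {v : EuclideanSpace ℝ (Fin n) → ℝ}
    {V : EuclideanSpace ℝ (Fin n) → EuclideanSpace ℝ (Fin n)} (hβ : ContDiff ℝ (⊤ : ℕ∞) β)
    (hv : ContDiff ℝ (⊤ : ℕ∞) v) (hvV : ∀ x e, fderiv ℝ v x e = inner ℝ (V x) e)
    (x e : EuclideanSpace ℝ (Fin n)) :
    fderiv ℝ (fun x => β (v x)) x e = deriv β (v x) * inner ℝ (V x) e := by
  have h1 : HasFDerivAt (fun x => β (v x)) (deriv β (v x) • fderiv ℝ v x) x :=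
    ((hβ.differentiable (by simp) _).hasDerivAt).comp_hasFDerivAt x
      (hv.differentiable (by simp) x).hasFDerivAt
  rw [h1.fderiv]
  simp [hvV]

/-- Chain rule for weak gradients. -/
theorem isWeakGradient_comp (hu : MemLp u 2) (hG : MemLp G 2) (h : IsWeakGradient u G)
    (hβ : ContDiff ℝ (⊤ : ℕ∞) β) (hB : ∀ t, |β t| ≤ B) (hC : ∀ t, |deriv β t| ≤ C) :
    IsWeakGradient (fun x => β (u x)) (fun x => deriv β (u x) • G x) := by
  have hdc : Continuous (deriv β) := hβ.continuous_deriv (by simp)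
  have hβu : AEStronglyMeasurable (fun x => β (u x)) :=
    hβ.continuous.comp_aestronglyMeasurable hu.1
  have hdu : AEStronglyMeasurable (fun x => deriv β (u x)) := hdc.comp_aestronglyMeasurable hu.1
  have hbG : MemLp (fun x => deriv β (u x) • G x) 2 :=
    (hG.const_smul C).mono (hdu.smul hG.1) (Eventually.of_forall fun x => by
      simp only [Pi.smul_apply, norm_smul]
      exact mul_le_mul_of_nonneg_right ((hC _).trans (le_abs_self C)) (norm_nonneg _))
  refine ⟨?_, hbG.locallyIntegrable (by norm_num), fun φ hφ hφc e => ?_⟩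
  · exact (memLp_top_of_bound hβu B (Eventually.of_forall fun x => hB _)).locallyIntegrable le_top
  obtain ⟨v, V, hv, hvV, hV, hvu, hVG⟩ := exists_smooth_approximation hu hG h
  have hφi : Integrable (fun x => fderiv ℝ φ x e) :=
    ((hφ.continuous_fderiv (by simp)).clm_apply continuous_const).integrable_of_hasCompactSupport
      (hφc.fderiv_apply (𝕜 := ℝ) e)
  have hP : MemLp (fun x => φ x • e) 2 :=
    (hφ.continuous.smul continuous_const).memLp_of_hasCompactSupport hφc.smul_right
  have hL : Tendsto (fun k => ∫ x, β (v k x) * fderiv ℝ φ x e) atTop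
      (𝓝 (∫ x, β (u x) * fderiv ℝ φ x e)) := by
    refine tendsto_integral_of_dominated_convergence (fun x => B * ‖fderiv ℝ φ x e‖)
      (fun k => (hβ.continuous.comp (hv k).continuous).aestronglyMeasurable.mul hφi.1)
      (hφi.norm.const_mul B) (fun k => Eventually.of_forall fun x => ?_) ?_
    · rw [norm_mul]
      exact mul_le_mul_of_nonneg_right (hB _) (norm_nonneg _)
    · filter_upwards [hvu] with x hx
      exact ((hβ.continuous.tendsto _).comp hx).mul_const _
  have hR := tendsto_integral_mul_inner hV hG hP
    (fun k => (hdc.comp (hv k).continuous).aestronglyMeasurable) (fun k x => hC (v k x))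
    (hvu.mono fun x hx => (hdc.tendsto _).comp hx) hVG
  have heq : ∀ k, ∫ x, β (v k x) * fderiv ℝ φ x e =
      - ∫ x, deriv β (v k x) * inner ℝ (V k x) (φ x • e) := by
    intro k
    have hβv : ContDiff ℝ (⊤ : ℕ∞) (fun x => β (v k x)) := hβ.comp (hv k)
    rw [integral_mul_fderiv_eq_neg_fderiv_mul_of_integrable
      (((hβv.continuous_fderiv (by simp)).clm_apply continuous_const).mul hφ.continuous
        |>.integrable_of_hasCompactSupport hφc.mul_left)
      (hφi.bdd_mul hβv.continuous.aestronglyMeasurable (Eventually.of_forall fun x => hB _))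
      ((hβv.continuous.mul hφ.continuous).integrable_of_hasCompactSupport hφc.mul_left)
      (fun x _ => hβv.differentiable (by simp) x) (fun x _ => hφ.differentiable (by simp) x)]
    congr 1
    refine integral_congr_ae (Eventually.of_forall fun x => ?_)
    simp only [fderiv_comp_of_fderiv hβ (hv k) (hvV k), inner_smul_right]
    ring
  have hlim := tendsto_nhds_unique hL ((hR.neg).congr fun k => (heq k).symm)
  rw [hlim]
  congr 1
  refine integral_congr_ae (Eventually.of_forall fun x => ?_)
  simp only [inner_smul_left, inner_smul_right, RCLike.conj_to_real]
  ring

end Composition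

/-! ### Energy estimates and the weak maximum principle. -/

variable {q : EuclideanSpace ℝ (Fin n) → ℝ} {β : ℝ → ℝ} {B C : ℝ}

theorem integrable_fderiv_apply {η : EuclideanSpace ℝ (Fin n) → ℝ} (hG : MemLp G 2)
    (hη : ContDiff ℝ (⊤ : ℕ∞) η) (hηc : HasCompactSupport η) :
    Integrable (fun x => fderiv ℝ η x (G x)) := by
  have hc : Continuous (fderiv ℝ η) := hη.continuous_fderiv (by simp)
  have h1 : MemLp (fun x => ‖fderiv ℝ η x‖) 2 :=
    (hc.memLp_of_hasCompactSupport (hηc.fderiv (𝕜 := ℝ))).norm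
  refine (h1.integrable_mul hG.norm).mono' ?_
    (Eventually.of_forall fun x => (fderiv ℝ η x).le_opNorm (G x))
  exact (ContinuousLinearMap.id ℝ _).aestronglyMeasurable_comp₂ hc.aestronglyMeasurable hG.1

/-- Testing `-Δu + q = 0` with `β(u) η`. -/
theorem integral_test_comp_mul (hu : MemLp u 2) (hG : MemLp G 2) (h : IsWeakGradient u G)
    (hq : LocallyIntegrable q)
    (heq : ∀ φ : EuclideanSpace ℝ (Fin n) → ℝ, ContDiff ℝ (⊤ : ℕ∞) φ → HasCompactSupport φ →
      ∫ x, (fderiv ℝ φ x (G x) + q x * φ x) = 0)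
    (hβ : ContDiff ℝ (⊤ : ℕ∞) β) (hB : ∀ t, |β t| ≤ B) (hC : ∀ t, |deriv β t| ≤ C)
    {η : EuclideanSpace ℝ (Fin n) → ℝ} (hη : ContDiff ℝ (⊤ : ℕ∞) η) (hηc : HasCompactSupport η) :
    (∫ x, deriv β (u x) * ‖G x‖ ^ 2 * η x) +
      ∫ x, β (u x) * (fderiv ℝ η x (G x) + η x * q x) = 0 := by
  obtain ⟨v, V, hv, hvV, hV, hvu, hVG⟩ := exists_smooth_approximation hu hG h
  have hdc : Continuous (deriv β) := hβ.continuous_deriv (by simp)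
  have hP : MemLp (fun x => η x • G x) 2 := by
    obtain ⟨K, hK⟩ := hηc.exists_bound_of_continuous hη.continuous
    refine (hG.const_smul K).mono (hη.continuous.aestronglyMeasurable.smul hG.1)
      (Eventually.of_forall fun x => ?_)
    simp only [Pi.smul_apply, norm_smul]
    exact mul_le_mul_of_nonneg_right ((hK x).trans (le_abs_self K)) (norm_nonneg _)
  have hQ : Integrable (fun x => fderiv ℝ η x (G x) + η x * q x) :=
    (integrable_fderiv_apply hG hη hηc).add
      (hq.integrable_smul_left_of_hasCompactSupport hη.continuous hηc)
  have hL := tendsto_integral_mul_inner hV hG hP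
    (fun k => (hdc.comp (hv k).continuous).aestronglyMeasurable) (fun k x => hC (v k x))
    (hvu.mono fun x hx => (hdc.tendsto _).comp hx) hVG
  -- Boundedness of `β` provides the dominating function although `q` is only locally integrable.
  have hR : Tendsto (fun k => ∫ x, β (v k x) * (fderiv ℝ η x (G x) + η x * q x)) atTop
      (𝓝 (∫ x, β (u x) * (fderiv ℝ η x (G x) + η x * q x))) := by
    refine tendsto_integral_of_dominated_convergence
      (fun x => B * ‖fderiv ℝ η x (G x) + η x * q x‖)
      (fun k => (hβ.continuous.comp (hv k).continuous).aestronglyMeasurable.mul hQ.1)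
      (hQ.norm.const_mul B) (fun k => Eventually.of_forall fun x => ?_) ?_
    · rw [norm_mul]
      exact mul_le_mul_of_nonneg_right (hB _) (norm_nonneg _)
    · filter_upwards [hvu] with x hx
      exact ((hβ.continuous.tendsto _).comp hx).mul_const _
  have hz : ∀ k, (∫ x, deriv β (v k x) * inner ℝ (V k x) (η x • G x)) +
      ∫ x, β (v k x) * (fderiv ℝ η x (G x) + η x * q x) = 0 := by
    intro k
    have hβv : ContDiff ℝ (⊤ : ℕ∞) (fun x => β (v k x)) := hβ.comp (hv k)
    have hi : Integrable (fun x => deriv β (v k x) * inner ℝ (V k x) (η x • G x)) :=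
      (integrable_inner_of_memLp (hV k) hP).bdd_mul
        (hdc.comp (hv k).continuous).aestronglyMeasurable (Eventually.of_forall fun x => hC _)
    rw [← integral_add hi
      (hQ.bdd_mul hβv.continuous.aestronglyMeasurable (Eventually.of_forall fun x => hB _)),
      ← heq (fun x => β (v k x) * η x) (hβv.mul hη) hηc.mul_left]
    refine integral_congr_ae (Eventually.of_forall fun x => ?_)
    have h2 := (hβv.differentiable (by simp) x).hasFDerivAt.mul
      (hη.differentiable (by simp) x).hasFDerivAt
    have h3 : fderiv ℝ (fun x => β (v k x) * η x) x = _ := h2.fderiv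
    simp only [h3, _root_.add_apply, _root_.smul_apply, smul_eq_mul,
      fderiv_comp_of_fderiv hβ (hv k) (hvV k), inner_smul_right]
    ring
  have hlim := tendsto_nhds_unique (hL.add hR)
    ((tendsto_const_nhds (x := (0 : ℝ))).congr fun k => (hz k).symm)
  rw [← hlim]
  congr 1
  refine integral_congr_ae (Eventually.of_forall fun x => ?_)
  simp only [inner_smul_right, real_inner_self_eq_norm_sq]
  ring

/-- A Caccioppoli inequality. -/
theorem integral_deriv_comp_mul_le (hu : MemLp u 2) (hG : MemLp G 2) (h : IsWeakGradient u G)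
    (hq : LocallyIntegrable q)
    (heq : ∀ φ : EuclideanSpace ℝ (Fin n) → ℝ, ContDiff ℝ (⊤ : ℕ∞) φ → HasCompactSupport φ →
      ∫ x, (fderiv ℝ φ x (G x) + q x * φ x) = 0)
    (hβ : ContDiff ℝ (⊤ : ℕ∞) β) (hB : ∀ t, |β t| ≤ B) (hC : ∀ t, |deriv β t| ≤ C)
    (hβu : MemLp (fun x => β (u x)) 2) (hsign : ∀ᵐ x, 0 ≤ β (u x) * q x)
    {η : EuclideanSpace ℝ (Fin n) → ℝ} (hη : ContDiff ℝ (⊤ : ℕ∞) η) (hηc : HasCompactSupport η)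
    (hη0 : ∀ x, 0 ≤ η x) {M : ℝ} (hM : ∀ x, ‖fderiv ℝ η x‖ ≤ M) :
    ∫ x, deriv β (u x) * ‖G x‖ ^ 2 * η x ≤ M * ∫ x, |β (u x)| * ‖G x‖ := by
  have hmain := integral_test_comp_mul hu hG h hq heq hβ hB hC hη hηc
  have hint : Integrable (fun x => |β (u x)| * ‖G x‖) := hβu.norm.integrable_mul hG.norm
  have hQ : Integrable (fun x => fderiv ℝ η x (G x) + η x * q x) :=
    (integrable_fderiv_apply hG hη hηc).add
      (hq.integrable_smul_left_of_hasCompactSupport hη.continuous hηc)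
  -- The term `β(u) q η` is nonnegative and is dropped; only the one with `∇η` has to be bounded.
  have hlow : ∫ x, -(M * (|β (u x)| * ‖G x‖)) ≤
      ∫ x, β (u x) * (fderiv ℝ η x (G x) + η x * q x) := by
    refine integral_mono_ae (hint.const_mul M).neg
      (hQ.bdd_mul hβu.1 (Eventually.of_forall fun x => hB _)) ?_
    filter_upwards [hsign] with x hx
    have h1 : |β (u x) * fderiv ℝ η x (G x)| ≤ |β (u x)| * (M * ‖G x‖) := by
      rw [abs_mul]
      gcongr
      exact ((fderiv ℝ η x).le_opNorm (G x)).trans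
        (mul_le_mul_of_nonneg_right (hM x) (norm_nonneg _))
    have h2 := neg_le_of_abs_le h1
    have h3 := mul_nonneg (hη0 x) hx
    linarith [h3]
  rw [integral_neg, integral_const_mul] at hlow
  linarith

/-- A standard cutoff function, equal to `1` near the origin. -/
noncomputable def cutoff (n : ℕ) : ContDiffBump (0 : EuclideanSpace ℝ (Fin n)) :=
  ⟨1, 2, by norm_num, by norm_num⟩

/-- If `-Δu + q = 0` with `β(u) q ≥ 0` and `β` is nondecreasing, then `β(u)` has zero gradient. -/
theorem deriv_comp_smul_ae_eq_zero (hu : MemLp u 2) (hG : MemLp G 2) (h : IsWeakGradient u G)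
    (hq : LocallyIntegrable q)
    (heq : ∀ φ : EuclideanSpace ℝ (Fin n) → ℝ, ContDiff ℝ (⊤ : ℕ∞) φ → HasCompactSupport φ →
      ∫ x, (fderiv ℝ φ x (G x) + q x * φ x) = 0)
    (hβ : ContDiff ℝ (⊤ : ℕ∞) β) (hB : ∀ t, |β t| ≤ B) (hC : ∀ t, |deriv β t| ≤ C)
    (hmono : Monotone β)
    (hβu : MemLp (fun x => β (u x)) 2) (hsign : ∀ᵐ x, 0 ≤ β (u x) * q x) :
    (fun x => deriv β (u x) • G x) =ᵐ[volume] 0 := by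
  have hdc : Continuous (deriv β) := hβ.continuous_deriv (by simp)
  set χ := cutoff n
  have hχ : ContDiff ℝ (⊤ : ℕ∞) χ := χ.contDiff
  obtain ⟨M, hM⟩ := (χ.hasCompactSupport.fderiv (𝕜 := ℝ)).exists_bound_of_continuous
    (hχ.continuous_fderiv (by simp))
  -- The cutoffs `χ(r k • x)` exhaust the space and their gradients are at most `r k * M`. As
  -- `|β(u)| ‖G‖` is integrable, the right side of the Caccioppoli inequality tends to `0`.
  set r : ℕ → ℝ := fun k => 1 / ((k : ℝ) + 1)
  have hr : ∀ k, 0 < r k := fun k => by positivity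
  have hr0 : Tendsto r atTop (𝓝 0) := tendsto_one_div_add_atTop_nhds_zero_nat
  have hle : ∀ k, ∫ x, deriv β (u x) * ‖G x‖ ^ 2 * χ (r k • x) ≤
      r k * M * ∫ x, |β (u x)| * ‖G x‖ := by
    intro k
    refine integral_deriv_comp_mul_le hu hG h hq heq hβ hB hC hβu hsign
      (η := fun x => χ (r k • x)) (hχ.comp (contDiff_const_smul _))
      (χ.hasCompactSupport.comp_smul (hr k).ne') (fun x => χ.nonneg) fun x => ?_
    have h1 := ((hχ.differentiable (by simp) (r k • x)).hasFDerivAt).comp x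
      ((hasFDerivAt_id x).const_smul (r k))
    have h2 : fderiv ℝ (fun x => χ (r k • x)) x = _ := h1.fderiv
    rw [h2, ContinuousLinearMap.comp_smul, norm_smul, Real.norm_of_nonneg (hr k).le]
    exact mul_le_mul_of_nonneg_left (hM _) (hr k).le
  have hint : Integrable (fun x => deriv β (u x) * ‖G x‖ ^ 2) :=
    (hG.integrable_norm_pow (by norm_num)).bdd_mul (hdc.comp_aestronglyMeasurable hu.1)
      (Eventually.of_forall fun x => hC _)
  have hnn : ∀ x, 0 ≤ deriv β (u x) * ‖G x‖ ^ 2 := fun x =>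
    mul_nonneg hmono.deriv_nonneg (by positivity)
  have hlim : Tendsto (fun k => ∫ x, deriv β (u x) * ‖G x‖ ^ 2 * χ (r k • x)) atTop
      (𝓝 (∫ x, deriv β (u x) * ‖G x‖ ^ 2)) := by
    refine tendsto_integral_of_dominated_convergence (fun x => deriv β (u x) * ‖G x‖ ^ 2)
      (fun k => hint.1.mul (hχ.continuous.comp (continuous_const_smul _)).aestronglyMeasurable)
      hint (fun k => Eventually.of_forall fun x => ?_) (Eventually.of_forall fun x => ?_)
    · rw [Real.norm_of_nonneg (mul_nonneg (hnn x) χ.nonneg)]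
      exact mul_le_of_le_one_right (hnn x) χ.le_one
    · have h1 : Tendsto (fun k => χ (r k • x)) atTop (𝓝 (χ ((0 : ℝ) • x))) :=
        (hχ.continuous.tendsto _).comp (hr0.smul_const x)
      rw [zero_smul, χ.one_of_mem_closedBall (Metric.mem_closedBall_self χ.rIn_pos.le)] at h1
      simpa using h1.const_mul (deriv β (u x) * ‖G x‖ ^ 2)
  have hle0 : ∫ x, deriv β (u x) * ‖G x‖ ^ 2 ≤ 0 := by
    refine le_of_tendsto_of_tendsto' hlim ?_ hle
    simpa using (hr0.mul_const M).mul_const (∫ x, |β (u x)| * ‖G x‖)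
  have hzero := (integral_eq_zero_iff_of_nonneg hnn hint).mp
    (le_antisymm hle0 (integral_nonneg hnn))
  filter_upwards [hzero] with x hx
  have : deriv β (u x) = 0 ∨ G x = 0 := by simpa using hx
  rcases this with h | h <;> simp [h]

/-- The derivative is continuous and vanishes outside `[0, 1]`. -/
theorem exists_bound_deriv_smoothTransition : ∃ C, ∀ t, |deriv Real.smoothTransition t| ≤ C := by
  have hc : HasCompactSupport (deriv Real.smoothTransition) := by
    refine HasCompactSupport.intro (isCompact_Icc (a := (0 : ℝ)) (b := 1)) fun x hx => ?_
    rcases lt_or_ge x 0 with h0 | h0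
    · have : Real.smoothTransition =ᶠ[𝓝 x] fun _ => 0 := by
        filter_upwards [Iio_mem_nhds h0] with y hy
        exact Real.smoothTransition.zero_of_nonpos (le_of_lt hy)
      rw [this.deriv_eq, deriv_const]
    · have h1 : 1 < x := by
        by_contra h1
        exact hx ⟨h0, not_lt.mp h1⟩
      have : Real.smoothTransition =ᶠ[𝓝 x] fun _ => 1 := by
        filter_upwards [Ioi_mem_nhds h1] with y hy
        exact Real.smoothTransition.one_of_one_le (le_of_lt hy)
      rw [this.deriv_eq, deriv_const]
  exact hc.exists_bound_of_continuous
    ((Real.smoothTransition.contDiff (n := (⊤ : ℕ∞))).continuous_deriv (by simp))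

/-- Weak maximum principle: if `-Δu + q = 0` with `q ≥ 0` where `u > s > 0`, then `u ≤ s`. -/
theorem ae_le_of_weak_solution (hn : n ≠ 0) {s : ℝ} (hs : 0 < s) (hu : MemLp u 2)
    (hG : MemLp G 2) (h : IsWeakGradient u G) (hq : LocallyIntegrable q)
    (heq : ∀ φ : EuclideanSpace ℝ (Fin n) → ℝ, ContDiff ℝ (⊤ : ℕ∞) φ → HasCompactSupport φ →
      ∫ x, (fderiv ℝ φ x (G x) + q x * φ x) = 0)
    (hsign : ∀ᵐ x, s < u x → 0 ≤ q x) : ∀ᵐ x, u x ≤ s := by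
  obtain ⟨C, hC⟩ := exists_bound_deriv_smoothTransition
  -- A smooth bounded substitute for the usual test function `(u - s)⁺`, with the same zero set.
  set β : ℝ → ℝ := fun t => Real.smoothTransition (t - s)
  have hβ : ContDiff ℝ (⊤ : ℕ∞) β :=
    Real.smoothTransition.contDiff.comp (contDiff_id.sub contDiff_const)
  have hB : ∀ t, |β t| ≤ 1 := fun t => by
    rw [abs_of_nonneg (Real.smoothTransition.nonneg _)]
    exact Real.smoothTransition.le_one _
  have hC' : ∀ t, |deriv β t| ≤ C := fun t => by
    rw [deriv_comp_sub_const]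
    exact hC _
  have hmono : Monotone β := fun a b hab =>
    Real.smoothTransition.monotone (by linarith)
  have hβu : MemLp (fun x => β (u x)) 2 := by
    -- Since `s > 0`, `β(u)` is dominated by `|u| / s`: it is at most `1`, and nonzero only where `u
    -- > s`.
    refine (hu.const_smul s⁻¹).mono (hβ.continuous.comp_aestronglyMeasurable hu.1)
      (Eventually.of_forall fun x => ?_)
    rcases le_or_gt (u x) s with hx | hx
    · have : β (u x) = 0 := Real.smoothTransition.zero_of_nonpos (by linarith)
      rw [this, norm_zero]
      exact norm_nonneg _
    · refine (hB (u x)).trans ?_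
      rw [Pi.smul_apply, norm_smul, Real.norm_of_nonneg (inv_pos.mpr hs).le,
        Real.norm_of_nonneg (hs.trans hx).le, inv_mul_eq_div, one_le_div hs]
      exact hx.le
  have hz := deriv_comp_smul_ae_eq_zero hu hG h hq heq hβ hB hC' hmono hβu (by
    filter_upwards [hsign] with x hx
    rcases le_or_gt (u x) s with h1 | h1
    · have : β (u x) = 0 := Real.smoothTransition.zero_of_nonpos (by linarith)
      rw [this, zero_mul]
    · exact mul_nonneg (Real.smoothTransition.nonneg _) (hx h1))
  obtain ⟨hl, -, hw⟩ := isWeakGradient_comp hu hG h hβ hB hC'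
  have hw0 : IsWeakGradient (fun x => β (u x)) 0 := by
    refine ⟨hl, locallyIntegrable_zero, fun φ hφ hφc e => ?_⟩
    rw [hw φ hφ hφc e]
    congr 1
    refine integral_congr_ae ?_
    filter_upwards [hz] with x hx
    rw [hx]
  filter_upwards [ae_eq_zero_of_isWeakGradient_zero hn hβu hw0] with x hx
  have := Real.smoothTransition.zero_iff_nonpos.mp hx
  linarith

/-! ### The original and the modified nonlinear terms. -/

section Potential

variable {N : ℝ → ℝ} {m s₁ : ℝ}

theorem hasDerivAt_of_contDiffOn_Ici (hN : ContDiffOn ℝ 1 N (Set.Ici 0)) {s : ℝ} (hs : 0 < s) :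
    HasDerivAt N (deriv N s) s :=
  (((hN.differentiableOn (by simp)) s hs.le).differentiableAt (Ici_mem_nhds hs)).hasDerivAt

theorem hasDerivAt_potential {c s : ℝ} (hN : HasDerivAt N c s) :
    HasDerivAt (potential m N) (m ^ 2 * s + c) s := by
  have h := (((hasDerivAt_id s).pow 2).const_mul (m ^ 2 / 2)).add hN
  refine h.congr_deriv ?_
  simp
  ring

theorem hasDerivAt_affine (a b s : ℝ) : HasDerivAt (fun t => a * t + b) a s := by
  simpa using ((hasDerivAt_id s).const_mul a).add_const b

theorem hasDerivAt_modifiedNonlinearity_of_gt {s : ℝ} (hs : s₁ < s) :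
    HasDerivAt (modifiedNonlinearity N s₁) (deriv N s₁) s := by
  refine (hasDerivAt_affine (deriv N s₁) (N s₁ - deriv N s₁ * s₁) s).congr_of_eventuallyEq ?_
  filter_upwards [Ioi_mem_nhds hs] with t ht
  exact if_neg (not_le.mpr ht)

theorem hasDerivAt_modifiedNonlinearity_of_le (hN : ContDiffOn ℝ 1 N (Set.Ici 0)) {s : ℝ}
    (hs : 0 < s) (hs₁ : s ≤ s₁) : HasDerivAt (modifiedNonlinearity N s₁) (deriv N s) s := by
  have hd := hasDerivAt_of_contDiffOn_Ici hN hs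
  rcases hs₁.lt_or_eq with h | rfl
  · refine hd.congr_of_eventuallyEq ?_
    filter_upwards [Iio_mem_nhds h] with t ht
    exact if_pos (le_of_lt ht)
  -- At the junction the affine piece is the tangent line of `N`, so the one-sided derivatives agree
  -- and glue.
  · have hl : HasDerivWithinAt (modifiedNonlinearity N s) (deriv N s) (Set.Iic s) s :=
      hd.hasDerivWithinAt.congr (fun t ht => if_pos ht) (if_pos le_rfl)
    have hr : HasDerivWithinAt (modifiedNonlinearity N s) (deriv N s) (Set.Ici s) s := by
      refine (hasDerivAt_affine (deriv N s) (N s - deriv N s * s) s).hasDerivWithinAt.congr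
        (fun t ht => ?_) ?_
      · rcases (Set.mem_Ici.mp ht).eq_or_lt with rfl | h
        · simp [modifiedNonlinearity]
        · exact if_neg (not_le.mpr h)
      · simp [modifiedNonlinearity]
    have := hl.union hr
    rwa [Set.Iic_union_Ici, hasDerivWithinAt_univ] at this

theorem fieldDeriv_modified_of_gt (h0 : 0 < s₁) {s : ℝ} (hs : s₁ < s) :
    fieldDeriv (potential m (modifiedNonlinearity N s₁)) s = m ^ 2 * s + deriv N s₁ := by
  have hs0 := h0.trans hs
  rw [fieldDeriv, abs_of_pos hs0, div_self hs0.ne', mul_one,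
    (hasDerivAt_potential (hasDerivAt_modifiedNonlinearity_of_gt hs)).deriv]

theorem fieldDeriv_modified_eq (hN : ContDiffOn ℝ 1 N (Set.Ici 0)) {s : ℝ} (hs : 0 ≤ s)
    (hs₁ : s ≤ s₁) :
    fieldDeriv (potential m (modifiedNonlinearity N s₁)) s = fieldDeriv (potential m N) s := by
  rcases hs.eq_or_lt with rfl | h
  -- At `0` both sides are `0`, because `0 / |0| = 0`.
  · simp [fieldDeriv]
  · rw [fieldDeriv, fieldDeriv, abs_of_pos h,
      (hasDerivAt_potential (hasDerivAt_modifiedNonlinearity_of_le hN h hs₁)).deriv,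
      (hasDerivAt_potential (hasDerivAt_of_contDiffOn_Ici hN h)).deriv]

end Potential

theorem IsH1Solution.congr {F F' : ℝ → ℝ} {ω : ℝ} (hu : IsH1Solution F ω u)
    (h : (fun x => fieldDeriv F (u x)) =ᵐ[volume] fun x => fieldDeriv F' (u x)) :
    IsH1Solution F' ω u := by
  obtain ⟨hu2, hloc, G, hG, hw, heq⟩ := hu
  refine ⟨hu2, fun x => ?_, G, hG, hw, fun φ hφ hφc => ?_⟩
  · obtain ⟨U, hU, hi⟩ := hloc x
    exact ⟨U, hU, hi.congr (ae_restrict_of_ae h)⟩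
  · rw [← heq φ hφ hφc]
    refine integral_congr_ae ?_
    filter_upwards [h] with x hx
    rw [hx]

end KleinGordon

/-! ### Conclusion. -/

open KleinGordon in
theorem proposition15 (n : ℕ) (hn : 3 ≤ n) (m ω : ℝ) (N : ℝ → ℝ)
    (hN : ContDiffOn ℝ 1 N (Set.Ici 0)) (hN0 : N 0 = 0) (hN0' : derivWithin N (Set.Ici 0) 0 = 0)
    (s₀ s₁ : ℝ) (hs₀ : 0 ≤ s₀) (hNs₀ : N s₀ < 0) (hs₁ : s₀ < s₁) (hNs₁ : 0 ≤ deriv N s₁)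
    (hmω : ω ^ 2 ≤ m ^ 2) (u : EuclideanSpace ℝ (Fin n) → ℝ)
    (hu : KleinGordon.IsH1Solution
      (KleinGordon.potential m (KleinGordon.modifiedNonlinearity N s₁)) ω u) :
    (∀ᵐ x, u x ≤ s₁) ∧
      ((∀ᵐ x, 0 ≤ u x) → KleinGordon.IsH1Solution (KleinGordon.potential m N) ω u) := by
  have hs₁0 : 0 < s₁ := hs₀.trans_lt hs₁
  have hle : ∀ᵐ x, u x ≤ s₁ := by
    obtain ⟨hu2, hloc, G, hG, hw, heq⟩ := hu
    have hul : LocallyIntegrable u := hw.1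
    refine ae_le_of_weak_solution (by lia) hs₁0 hu2 hG hw
      (q := fun x => fieldDeriv (potential m (modifiedNonlinearity N s₁)) (u x) - ω ^ 2 * u x)
      (hloc.sub (hul.smul (ω ^ 2))) (fun φ hφ hφc => ?_)
      (Filter.Eventually.of_forall fun x hx => ?_)
    · have h1 : Integrable (fun x => u x * φ x) :=
        hul.integrable_smul_right_of_hasCompactSupport hφ.continuous hφc
      have h2 : Integrable (fun x =>
          fieldDeriv (potential m (modifiedNonlinearity N s₁)) (u x) * φ x) :=
        hloc.integrable_smul_right_of_hasCompactSupport hφ.continuous hφc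
      have h3 : Integrable (fun x => fderiv ℝ φ x (G x) +
          fieldDeriv (potential m (modifiedNonlinearity N s₁)) (u x) * φ x) :=
        (integrable_fderiv_apply hG hφ hφc).add h2
      rw [← sub_eq_zero.mpr (heq φ hφ hφc), ← integral_const_mul,
        ← integral_sub h3 (h1.const_mul _)]
      refine integral_congr_ae (Filter.Eventually.of_forall fun x => ?_)
      ring
    · rw [fieldDeriv_modified_of_gt hs₁0 hx]
      have hux : 0 < u x := hs₁0.trans hx
      -- The quantity is `(m² - ω²) u + N'(s₁)`, a sum of nonnegative terms.
      nlinarith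
  refine ⟨hle, fun h0 => hu.congr ?_⟩
  filter_upwards [hle, h0] with x h1 h2
  exact fieldDeriv_modified_eq hN h2 h1
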